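/- Let $H$ be a separable infinite-dimensional complex Hilbert space. A sequence $(s_k)_{k\ge1}$ of real numbers is called an eigenvalue sequence of a positive compact operator $T$ on $H$ if every nonzero number occurs in it exactly as many times as the dimension of the corresponding eigenspace of $T$ (the order being irrelevant), and $0$ occurs in it at most $\dim\ker T$ times. An operator is strictly positive if $\langle Tx,x\rangle>0$ for all $x\neq0$. (1) Let $0\le d_1\le d_2\le\cdots$ with $d_n/n\to0$. Then every positive compact operator $T$ on $H$ with eigenvalue sequence $$\Bigl(d_1,\tfrac{d_2-d_1}{2},\tfrac{d_2-d_1}{2},\tfrac{d_3-d_2}{3},\tfrac{d_3-d_2}{3},\tfrac{d_3-d_2}{3},\dots\Bigr)$$ (where $(d_n-d_{n-1})/n$ is repeated $n$ times) is a single commutator $T=CZ-ZC$ of compact operators $C,Z$ on $H$. (2) Let $d_n\ge0$ for $n\ge1$ with $\frac1n\sum_{j=1}^n d_j\to0$. Then every positive compact operator $T$ on $H$ with eigenvalue sequence $$\Bigl(d_1,\tfrac{d_2}{2},\tfrac{d_2}{2},\tfrac{d_3}{3},\tfrac{d_3}{3},\tfrac{d_3}{3},\dots\Bigr)$$ (where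 $d_n/n$ is repeated $n$ times) is a single commutator of compact operators on $H$. (3) The two conditions are equivalent: a sequence has the form displayed in (1) for some $(d_n)$ as in (1) if and only if it has the form displayed in (2) for some $(d_n)$ as in (2). (4) The sequences $d_n=\sqrt n$ and $d_n=\log(n+1)$ satisfy the hypotheses of (1), and for each of them there is a strictly positive compact operator on $H$ with the eigenvalue sequence of (1), which is thus a single commutator of compact operators. The sequence $d_n=\log n$ satisfies the hypotheses of (1) as well; there is a positive compact operator on $H$ with the corresponding eigenvalue sequence and a one-dimensional kernel (because $d_1=0$), and it is a single commutator of compact operators. -/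

import Mathlib

/-- A bounded operator is a (single) commutator of compact operators if it equals `C Z - Z C`
for some compact operators `C` and `Z` on the same space. -/
def IsCommutatorOfCompacts {H : Type*} [NormedAddCommGroup H] [InnerProductSpace ℂ H]
    (T : H →L[ℂ] H) : Prop :=
  ∃ C Z : H →L[ℂ] H, IsCompactOperator C ∧ IsCompactOperator Z ∧ T = C ∘L Z - Z ∘L C

/-- Strict positivity: `⟪T x, x⟫` is real and positive for all nonzero `x`
(a positive operator with trivial kernel; it need not be invertible). -/
def IsStrictlyPositiveOperator {H : Type*} [NormedAddCommGroup H] [InnerProductSpace ℂ H]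
    (T : H →L[ℂ] H) : Prop :=
  T.IsPositive ∧ ∀ x : H, x ≠ 0 → 0 < RCLike.re (inner ℂ (T x) x)

/-- `s` lists the eigenvalues of `T` with multiplicity, in no particular order: each nonzero
complex number occurs in `s` exactly as many times as the dimension of its eigenspace (so not at
all if it is not an eigenvalue), and `0` occurs at most `dim ker T` times. So the kernel may be
listed in full, in part, or not at all, which covers all the usual conventions on zeros. -/
def HasEigenvalueSequence {H : Type*} [NormedAddCommGroup H] [InnerProductSpace ℂ H]
    (T : H →L[ℂ] H) (s : ℕ → ℝ) : Prop :=
  (∀ μ : ℂ, μ ≠ 0 → {k : ℕ | (s k : ℂ) = μ}.encard =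
    Cardinal.toENat (Module.rank ℂ (Module.End.eigenspace (T : H →ₗ[ℂ] H) μ))) ∧
  {k : ℕ | s k = 0}.encard ≤
    Cardinal.toENat (Module.rank ℂ (LinearMap.ker (T : H →ₗ[ℂ] H)))

theorem exists_lt_triangle (k : ℕ) : ∃ n : ℕ, k < n * (n + 1) / 2 := by
  refine ⟨k + 1, ?_⟩
  have h : k + 1 ≤ (k + 1) * (k + 1 + 1) / 2 := by
    rw [Nat.le_div_iff_mul_le (by norm_num)]
    nlinarith
  omega

/-- Cut `0, 1, 2, 3, …` into consecutive blocks of lengths `1, 2, 3, …`; this is the number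
(and length) of the block that contains `k`: it takes the values `1, 2, 2, 3, 3, 3, 4, …`. -/
def blockNumber (k : ℕ) : ℕ := Nat.find (exists_lt_triangle k)

/-- The sequence `(a 1, a 2, a 2, a 3, a 3, a 3, …)`, in which `a n` is repeated `n` times. -/
def repeatBlocks (a : ℕ → ℝ) : ℕ → ℝ := fun k => a (blockNumber k)

/-- The sequence `(d 1, (d 2 - d 1)/2, (d 2 - d 1)/2, (d 3 - d 2)/3, …)`. Sequences `d` are
indexed from `1`; the value `d 0` is never used. -/
noncomputable def incrementEigenvalues (d : ℕ → ℝ) : ℕ → ℝ :=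
  repeatBlocks fun n => if n = 1 then d 1 else (d n - d (n - 1)) / n

/-- The sequence `(d 1, (d 2)/2, (d 2)/2, (d 3)/3, (d 3)/3, (d 3)/3, …)`. -/
noncomputable def directEigenvalues (d : ℕ → ℝ) : ℕ → ℝ :=
  repeatBlocks fun n => d n / n

/-- `0 ≤ d 1 ≤ d 2 ≤ …` and `d n / n → 0`. -/
def IncrementCondition (d : ℕ → ℝ) : Prop :=
  (∀ n, 1 ≤ n → 0 ≤ d n) ∧ (∀ n, 1 ≤ n → d n ≤ d (n + 1)) ∧
    Filter.Tendsto (fun n : ℕ => d n / n) Filter.atTop (nhds 0)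

/-- `d n ≥ 0` for `n ≥ 1`, and the arithmetic means `(d 1 + … + d n)/n` tend to `0`. -/
def MeanCondition (d : ℕ → ℝ) : Prop :=
  (∀ n, 1 ≤ n → 0 ≤ d n) ∧
    Filter.Tendsto (fun n : ℕ => (1 / (n : ℝ)) * ∑ j ∈ Finset.Icc 1 n, d j)
      Filter.atTop (nhds 0)

open Filter Topology

/-! The model is a pair of harmonic oscillators on `ℓ²(ℕ × ℕ)`, damped by a function `a` of the
total degree `N = i + j`. Let `A₁, A₂` be the lowering operators in the two variables, with weights
`√(a N (i + 1))` and `√(a N (j + 1))`, and let `B₁, B₂` be the corresponding raising operators. For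
`C = A₁ + B₂` and `Z = B₁ - A₂`, `[C, Z] = [A₁, B₁] + [A₂, B₂] - [A₁, A₂] - [B₁, B₂]`. The last two
commutators vanish because the damping depends on `N` alone. The first two are diagonal and add up
to `a N (N + 2) - a (N - 1) N`, again a function of `N`.

With `a n = d (n + 1) / ((n + 1)(n + 2))` this value is `(d (N + 1) - d N) / (N + 1)` for `N ≥ 1`
and `d 1` for `N = 0`. There are `N + 1` pairs of degree `N`, so the diagonal is exactly the
increment sequence. The weights are at most `√(a N (N + 1)) = √(d (N + 1) / (N + 2))` or the same
bound in degree `N - 1`; hence `d n / n → 0` makes all four operators compact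
(`exists_compact_commutator_total_degree`).

By the spectral theorem, `T` is this diagonal operator on an isometric copy of the model and zero on
its orthogonal complement, whatever part of the kernel the sequence lists
(`exists_orthonormal_eigenvectors`). Conjugation by the isometry carries `C` and `Z` over. The mean
condition is the increment condition for partial sums. -/

/-! ### Weighted composition operators on `ℓ²` -/

theorem sum_norm_sq_weightedComp_le {ι : Type*} {w : ι → ℂ} {τ : ι → ι} {M : ℝ}
    (hw : ∀ i, ‖w i‖ ≤ M) (hτ : Set.InjOn τ {i | w i ≠ 0}) (x : lp (fun _ : ι => ℂ) 2)
    (s : Finset ι) : ∑ i ∈ s, ‖w i * x (τ i)‖ ^ 2 ≤ (M * ‖x‖) ^ 2 := by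
  classical
  have h1 : ∑ i ∈ s, ‖w i * x (τ i)‖ ^ 2 = ∑ i ∈ s with w i ≠ 0, ‖w i * x (τ i)‖ ^ 2 := by
    rw [Finset.sum_filter]
    refine Finset.sum_congr rfl fun i _ => ?_
    split_ifs with h
    · rfl
    · simp [not_not.mp h]
  have h2 : ∑ i ∈ s with w i ≠ 0, ‖w i * x (τ i)‖ ^ 2 ≤
      ∑ i ∈ s with w i ≠ 0, M ^ 2 * ‖x (τ i)‖ ^ 2 := by
    refine Finset.sum_le_sum fun i _ => ?_
    rw [norm_mul, mul_pow]
    gcongr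
    exact hw i
  have hinj : Set.InjOn τ (s.filter fun i => w i ≠ 0) :=
    hτ.mono fun i hi => by simpa using (Finset.mem_filter.mp hi).2
  have h3 : ∑ i ∈ s with w i ≠ 0, ‖x (τ i)‖ ^ 2 ≤ ‖x‖ ^ 2 := by
    -- Injectivity on the support means that no coordinate of `x` is counted twice.
    rw [← Finset.sum_image (f := fun j => ‖x j‖ ^ 2) hinj]
    simpa using lp.sum_rpow_le_norm_rpow (p := 2) (by simp) x
      ((s.filter fun i => w i ≠ 0).image τ)
  calc ∑ i ∈ s, ‖w i * x (τ i)‖ ^ 2 ≤ M ^ 2 * ∑ i ∈ s with w i ≠ 0, ‖x (τ i)‖ ^ 2 := by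
        rw [h1, Finset.mul_sum]; exact h2
    _ ≤ M ^ 2 * ‖x‖ ^ 2 := by gcongr
    _ = (M * ‖x‖) ^ 2 := by ring

/-- Weighted composition with a map that is injective on the support of a bounded weight is a
bounded operator on `ℓ²`. -/
theorem exists_weightedComp {ι : Type*} {w : ι → ℂ} {τ : ι → ι} {M : ℝ} (hM : 0 ≤ M)
    (hw : ∀ i, ‖w i‖ ≤ M) (hτ : Set.InjOn τ {i | w i ≠ 0}) :
    ∃ S : lp (fun _ : ι => ℂ) 2 →L[ℂ] lp (fun _ : ι => ℂ) 2, ‖S‖ ≤ M ∧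
      ∀ x i, S x i = w i * x (τ i) := by
  have hmem (x : lp (fun _ : ι => ℂ) 2) : Memℓp (fun i => w i * x (τ i)) 2 :=
    memℓp_gen' (C := (M * ‖x‖) ^ 2) fun s => by
      simpa using sum_norm_sq_weightedComp_le hw hτ x s
  let S₀ : lp (fun _ : ι => ℂ) 2 →ₗ[ℂ] lp (fun _ : ι => ℂ) 2 :=
    { toFun := fun x => ⟨fun i => w i * x (τ i), hmem x⟩
      map_add' := fun x y => by
        ext i
        exact mul_add _ _ _
      map_smul' := fun c x => by
        ext i
        exact mul_left_comm _ _ _ }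
  have hS (x) : ‖S₀ x‖ ≤ M * ‖x‖ := by
    refine lp.norm_le_of_forall_sum_le (by simp) (by positivity) fun s => ?_
    simpa [S₀] using sum_norm_sq_weightedComp_le hw hτ x s
  exact ⟨S₀.mkContinuous M hS, S₀.mkContinuous_norm_le hM hS, fun x i => rfl⟩

/-- A weighted composition operator on `ℓ²` is compact if its weight tends to zero. -/
theorem exists_isCompactOperator_weightedComp {ι : Type*} {w : ι → ℂ} {τ : ι → ι}
    (hw : Tendsto w cofinite (𝓝 0)) (hτ : Set.InjOn τ {i | w i ≠ 0}) :
    ∃ S : lp (fun _ : ι => ℂ) 2 →L[ℂ] lp (fun _ : ι => ℂ) 2, IsCompactOperator S ∧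
      ∀ x i, S x i = w i * x (τ i) := by
  classical
  obtain ⟨M, hM⟩ := (hw.norm).bddAbove_range_of_cofinite
  obtain ⟨S, -, hS⟩ := exists_weightedComp (w := w) (τ := τ) (M := max M 0) (le_max_right _ _)
    (fun i => (hM ⟨i, rfl⟩).trans (le_max_left _ _)) hτ
  refine ⟨S, ?_, hS⟩
  -- `R i` keeps only output coordinate `i`. Finite sums of these are compact, and they converge to
  -- `S` in norm because the remaining weights are uniformly small.
  let R (i : ι) : lp (fun _ : ι => ℂ) 2 →L[ℂ] lp (fun _ : ι => ℂ) 2 :=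
    (lp.singleContinuousLinearMap ℂ (fun _ : ι => ℂ) 2 i) ∘L (w i • lp.evalCLM ℂ _ 2 (τ i))
  have hR (i x j) : R i x j = if j = i then w i * x (τ i) else 0 := by
    simp only [R, ContinuousLinearMap.coe_comp, Function.comp_apply,
      lp.singleContinuousLinearMap_apply, lp.single_apply, Pi.single_apply]
    rfl
  have hRc (s : Finset ι) : IsCompactOperator (∑ i ∈ s, R i : _ →L[ℂ] _) := by
    induction s using Finset.induction_on with
    | empty => simpa using isCompactOperator_zero
    | insert i s hi ih =>
      rw [Finset.sum_insert hi]
      have h : IsCompactOperator (lp.singleContinuousLinearMap ℂ (fun _ : ι => ℂ) 2 i) :=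
        isCompactOperator_of_locallyCompactSpace_rng
          (lp.singleContinuousLinearMap ℂ (fun _ : ι => ℂ) 2 i)
      exact IsCompactOperator.add (h.comp_clm (w i • lp.evalCLM ℂ _ 2 (τ i))) ih
  have hRs (s : Finset ι) (x j) : (∑ i ∈ s, R i) x j = if j ∈ s then w j * x (τ j) else 0 := by
    rw [sum_apply, lp.coeFn_sum, Finset.sum_apply]
    simp [hR]
  refine isCompactOperator_of_tendsto (l := atTop) (F := fun s : Finset ι => ∑ i ∈ s, R i) ?_
    (Eventually.of_forall hRc)
  rw [Metric.tendsto_atTop]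
  intro ε hε
  have hfin : {i | ¬ ‖w i‖ < ε / 2}.Finite := by
    simpa using (hw.norm).eventually (gt_mem_nhds (show ‖(0 : ℂ)‖ < ε / 2 by simpa using hε))
  refine ⟨hfin.toFinset, fun s hs => ?_⟩
  obtain ⟨S', hS'n, hS'⟩ := exists_weightedComp (w := fun i => if i ∈ s then 0 else w i) (τ := τ)
    (M := ε / 2) (by positivity) (fun i => by
      split_ifs with h
      · simpa using (half_pos hε).le
      · by_contra hc
        exact h (hs (by simpa using not_lt.mp fun hlt => hc hlt.le)))
    (hτ.mono fun i hi => by simp_all)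
  have hSS' : S - ∑ i ∈ s, R i = S' := by
    ext x j
    rw [sub_apply, lp.coeFn_sub, Pi.sub_apply, hRs, hS, hS']
    split_ifs <;> simp
  rw [dist_comm, dist_eq_norm, hSS']
  linarith

/-! ### The two-oscillator model -/

theorem tendsto_fst_add_snd_cofinite :
    Tendsto (fun p : ℕ × ℕ => p.1 + p.2) cofinite atTop := by
  rw [← Nat.cofinite_eq_atTop, Filter.tendsto_def]
  intro s hs
  rw [mem_cofinite] at hs ⊢
  rw [← Set.preimage_compl]
  obtain ⟨b, hb⟩ := hs.bddAbove
  refine ((Set.finite_Iic b).prod (Set.finite_Iic b)).subset fun p hp => ?_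
  have : p.1 + p.2 ≤ b := hb hp
  simp only [Set.mem_prod, Set.mem_Iic]
  omega

/-- The weights make the commutation relations of two harmonic oscillators hold up to a function
of the total degree. -/
theorem exists_compact_commutator_total_degree {a : ℕ → ℝ} (ha : ∀ n, 0 ≤ a n)
    (hlim : Tendsto (fun n : ℕ => a n * (n + 1)) atTop (𝓝 0)) :
    ∃ C Z : lp (fun _ : ℕ × ℕ => ℂ) 2 →L[ℂ] lp (fun _ : ℕ × ℕ => ℂ) 2,
      IsCompactOperator C ∧ IsCompactOperator Z ∧ ∀ x p, (C (Z x) - Z (C x)) p =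
        ((a (p.1 + p.2) * (p.1 + p.2 + 2) - a (p.1 + p.2 - 1) * (p.1 + p.2) : ℝ) : ℂ) * x p := by
  have hN := tendsto_fst_add_snd_cofinite
  have hN' : Tendsto (fun p : ℕ × ℕ => p.1 + p.2 - 1) cofinite atTop :=
    (tendsto_sub_atTop_nat 1).comp hN
  have hlim' : Tendsto (fun n : ℕ => √(a n * (n + 1))) atTop (𝓝 0) := by
    simpa using hlim.sqrt
  have key {N : ℕ × ℕ → ℕ} (hN : Tendsto N cofinite atTop) {v : ℕ × ℕ → ℕ}
      (hv : ∀ p, v p ≤ N p + 1) :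
      Tendsto (fun p => ((√(a (N p) * v p) : ℝ) : ℂ)) cofinite (𝓝 0) := by
    have : Tendsto (fun p => √(a (N p) * v p)) cofinite (𝓝 0) := by
      refine squeeze_zero (fun p => Real.sqrt_nonneg _) (fun p => ?_) (hlim'.comp hN)
      refine Real.sqrt_le_sqrt (mul_le_mul_of_nonneg_left ?_ (ha _))
      exact_mod_cast hv p
    exact Complex.ofReal_zero ▸ (Complex.continuous_ofReal.tendsto 0).comp this
  obtain ⟨A₁, hA₁, hA₁'⟩ := exists_isCompactOperator_weightedComp
    (τ := fun p : ℕ × ℕ => (p.1 + 1, p.2)) (key hN (v := fun p => p.1 + 1) fun p => by omega)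
    (fun p _ q _ h => by simpa [Prod.ext_iff] using h)
  obtain ⟨A₂, hA₂, hA₂'⟩ := exists_isCompactOperator_weightedComp
    (τ := fun p : ℕ × ℕ => (p.1, p.2 + 1)) (key hN (v := fun p => p.2 + 1) fun p => by omega)
    (fun p _ q _ h => by simpa [Prod.ext_iff] using h)
  obtain ⟨B₁, hB₁, hB₁'⟩ := exists_isCompactOperator_weightedComp
    (τ := fun p : ℕ × ℕ => (p.1 - 1, p.2)) (key hN' (v := fun p => p.1) fun p => by omega)
    (by
      -- Truncated subtraction identifies 0 and 1, but the weight vanishes at 0.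
      rintro ⟨i, j⟩ hp ⟨i', j'⟩ hq h
      have hi : i ≠ 0 := by rintro rfl; simp at hp
      have hi' : i' ≠ 0 := by rintro rfl; simp at hq
      simp only [Prod.mk.injEq] at h ⊢
      omega)
  obtain ⟨B₂, hB₂, hB₂'⟩ := exists_isCompactOperator_weightedComp
    (τ := fun p : ℕ × ℕ => (p.1, p.2 - 1)) (key hN' (v := fun p => p.2) fun p => by omega)
    (by
      rintro ⟨i, j⟩ hp ⟨i', j'⟩ hq h
      have hi : j ≠ 0 := by rintro rfl; simp at hp
      have hi' : j' ≠ 0 := by rintro rfl; simp at hq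
      simp only [Prod.mk.injEq] at h ⊢
      omega)
  have hα (n : ℕ) : ((√(a n) : ℝ) : ℂ) ^ 2 = a n := by
    rw [← Complex.ofReal_pow, Real.sq_sqrt (ha n)]
  have hr (n : ℕ) : ((√(n : ℝ) : ℝ) : ℂ) ^ 2 = n := by
    rw [← Complex.ofReal_pow, Real.sq_sqrt n.cast_nonneg, Complex.ofReal_natCast]
  -- This grouping keeps the commutators of `A₁` with `B₂` and of `A₂` with `B₁`, which need not
  -- vanish, out of the expansion.
  refine ⟨A₁ + B₂, B₁ - A₂, hA₁.add hB₂, hB₁.sub hA₂, fun x p => ?_⟩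
  obtain ⟨i, j⟩ := p
  simp only [add_apply, sub_apply, lp.coeFn_sub, lp.coeFn_add, Pi.sub_apply, Pi.add_apply,
    hA₁', hA₂', hB₁', hB₂', Real.sqrt_mul (ha _), Complex.ofReal_mul]
  have h1 (i j : ℕ) : i + 1 + j - 1 = i + j := by omega
  have h2 (i j : ℕ) : i + (j + 1) - 1 = i + j := by omega
  have hc (n : ℕ) : ((n + 1 : ℕ) : ℂ) = n + 1 := Nat.cast_succ n
  have hc1 : ((1 : ℕ) : ℂ) = 1 := Nat.cast_one
  -- On the boundary the raising weights vanish, which removes the terms with truncated indices.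
  rcases i with _ | i <;> rcases j with _ | j <;>
    simp only [h1, h2, Nat.cast_zero, Real.sqrt_zero, Complex.ofReal_zero, mul_zero, zero_mul,
      ← add_assoc, zero_add, add_zero, Nat.sub_self, Complex.ofReal_sub,
      Complex.ofReal_add, Complex.ofReal_mul, Complex.ofReal_natCast, Complex.ofReal_ofNat]
  · linear_combination 2 * x (0, 0) * ((√((1 : ℕ) : ℝ) : ℂ) ^ 2 * hα 0 + a 0 * (hr 1 + hc1))
  · rw [show 1 + j = j + 1 from add_comm 1 j]
    linear_combination x (0, j + 1) *
      ((((√((1 : ℕ) : ℝ) : ℂ) ^ 2 + (√((j + 1 + 1 : ℕ) : ℝ) : ℂ) ^ 2)) * hα (j + 1) +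
      a (j + 1) * (hr 1 + hc1 + hr (j + 1 + 1) + hc (j + 1)) -
      (√((j + 1 : ℕ) : ℝ) : ℂ) ^ 2 * hα j - a j * hr (j + 1))
  · linear_combination x (i + 1, 0) *
      ((((√((1 : ℕ) : ℝ) : ℂ) ^ 2 + (√((i + 1 + 1 : ℕ) : ℝ) : ℂ) ^ 2)) * hα (i + 1) +
      a (i + 1) * (hr 1 + hc1 + hr (i + 1 + 1) + hc (i + 1)) -
      (√((i + 1 : ℕ) : ℝ) : ℂ) ^ 2 * hα i - a i * hr (i + 1))
  · rw [show i + 1 + 1 + j = i + j + 1 + 1 by omega, show i + 1 + j = i + j + 1 by omega]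
    linear_combination x (i + 1, j + 1) *
      ((((√((i + 1 + 1 : ℕ) : ℝ) : ℂ) ^ 2 + (√((j + 1 + 1 : ℕ) : ℝ) : ℂ) ^ 2)) * hα (i + j + 1 + 1) +
      a (i + j + 1 + 1) * (hr (i + 1 + 1) + hc (i + 1) + hr (j + 1 + 1) + hc (j + 1)) -
      ((√((i + 1 : ℕ) : ℝ) : ℂ) ^ 2 + (√((j + 1 : ℕ) : ℝ) : ℂ) ^ 2) * hα (i + j + 1) -
      a (i + j + 1) * (hr (i + 1) + hr (j + 1)))

/-! ### Blocks and antidiagonals -/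

theorem blockNumber_eq_succ_iff (k m : ℕ) :
    blockNumber k = m + 1 ↔ k ∈ Finset.Ico (m * (m + 1) / 2) (m * (m + 1) / 2 + (m + 1)) := by
  have hstep (n : ℕ) : (n + 1) * (n + 1 + 1) / 2 = n * (n + 1) / 2 + (n + 1) := by
    rw [show (n + 1) * (n + 1 + 1) = n * (n + 1) + (n + 1) * 2 by ring,
      Nat.add_mul_div_right _ _ two_pos]
  have hmono : Monotone fun n : ℕ => n * (n + 1) / 2 :=
    monotone_nat_of_le_succ fun n => by simp only [hstep]; omega
  rw [blockNumber, Nat.find_eq_iff, Finset.mem_Ico, hstep, and_comm]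
  refine and_congr_left fun _ => ⟨fun h => ?_, fun h n hn => ?_⟩
  · exact not_lt.mp (h m (Nat.lt_succ_self m))
  · exact not_lt.mpr ((hmono (Nat.lt_succ_iff.mp hn)).trans h)

theorem blockNumber_pos (k : ℕ) : 0 < blockNumber k := by
  rw [Nat.pos_iff_ne_zero, blockNumber, Ne, Nat.find_eq_zero]
  simp

/-- Block `m + 1` and the antidiagonal of degree `m` both have `m + 1` elements, so the fibres can
be matched one by one. -/
theorem exists_equiv_blockNumber :
    ∃ φ : ℕ ≃ ℕ × ℕ, ∀ k, (φ k).1 + (φ k).2 + 1 = blockNumber k := by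
  have h (n : ℕ) : Nonempty ({k // blockNumber k = n} ≃ {p : ℕ × ℕ // p.1 + p.2 + 1 = n}) := by
    rcases n with _ | m
    · have : IsEmpty {k // blockNumber k = 0} := ⟨fun k => (blockNumber_pos k.1).ne' k.2⟩
      have : IsEmpty {p : ℕ × ℕ // p.1 + p.2 + 1 = 0} := ⟨fun p => Nat.succ_ne_zero _ p.2⟩
      exact ⟨Equiv.equivOfIsEmpty _ _⟩
    · have e₁ := Equiv.subtypeEquivRight fun k => blockNumber_eq_succ_iff k m
      have e₂ : {p : ℕ × ℕ // p ∈ Finset.HasAntidiagonal.antidiagonal m} ≃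
          {p : ℕ × ℕ // p.1 + p.2 + 1 = m + 1} :=
        Equiv.subtypeEquivRight fun p => by simp
      exact ⟨e₁.trans ((Finset.equivOfCardEq (by simp)).trans e₂)⟩
  exact ⟨Equiv.ofFiberEquiv fun n => (h n).some, fun k =>
    Equiv.ofFiberEquiv_map (g := fun p : ℕ × ℕ => p.1 + p.2 + 1) _ k⟩

theorem tendsto_blockNumber : Tendsto blockNumber cofinite atTop := by
  obtain ⟨φ, hφ⟩ := exists_equiv_blockNumber
  exact ((tendsto_add_atTop_nat 1).comp
    (tendsto_fst_add_snd_cofinite.comp φ.injective.tendsto_cofinite)).congr hφ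

/-! ### Transport along isometries and the spectral theorem -/

section Hilbert

variable {H : Type*} [NormedAddCommGroup H] [InnerProductSpace ℂ H]

/-- Compact commutators can be moved along an isometry, if the operator vanishes on the orthogonal
complement of the range. -/
theorem IsCommutatorOfCompacts.of_isometry [CompleteSpace H] {G : Type*} [NormedAddCommGroup G]
    [InnerProductSpace ℂ G] [CompleteSpace G] (V : G →ₗᵢ[ℂ] H) {C Z : G →L[ℂ] G}
    (hC : IsCompactOperator C) (hZ : IsCompactOperator Z) {T : H →L[ℂ] H}
    (hT : ∀ x, T (V x) = V (C (Z x) - Z (C x)))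
    (hT' : ∀ y, (∀ x, inner ℂ (V x) y = 0) → T y = 0) : IsCommutatorOfCompacts T := by
  let W : G →L[ℂ] H := V.toContinuousLinearMap
  have hW (x : G) : W.adjoint (W x) = x := by
    refine ext_inner_left ℂ fun v => ?_
    rw [ContinuousLinearMap.adjoint_inner_right]
    exact V.inner_map_map v x
  refine ⟨W ∘L C ∘L W.adjoint, W ∘L Z ∘L W.adjoint, (hC.comp_clm _).clm_comp W,
    (hZ.comp_clm _).clm_comp W, ?_⟩
  ext y
  have hy : T (y - W (W.adjoint y)) = 0 := hT' _ fun x => by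
    change inner ℂ (W x) _ = 0
    rw [← ContinuousLinearMap.adjoint_inner_right, map_sub, hW, sub_self, inner_zero_right]
  rw [map_sub, sub_eq_zero] at hy
  rw [hy, show T (W (W.adjoint y)) = _ from hT _]
  simp only [ContinuousLinearMap.coe_comp, Function.comp_apply, sub_apply, hW, map_sub]
  rfl

/-- `Cardinal.toENat` does not separate infinite cardinals; countability of the index type makes an
infinite Hilbert basis large enough. -/
theorem exists_orthonormal_subtype {ι : Type*} [Countable ι] (E : Submodule ℂ H)
    [CompleteSpace E] (A : Set ι) (hA : A.encard ≤ Cardinal.toENat (Module.rank ℂ E)) :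
    ∃ f : A → E, Orthonormal ℂ f := by
  by_cases hfin : FiniteDimensional ℂ E
  · rw [← Module.finrank_eq_rank, Cardinal.toENat_nat] at hA
    have hAf : A.Finite := Set.encard_lt_top_iff.mp (hA.trans_lt (ENat.natCast_lt_top _))
    have := hAf.fintype
    rw [Set.encard_eq_coe_toFinset_card, Set.toFinset_card, Nat.cast_le] at hA
    obtain ⟨g⟩ : Nonempty (A ↪ Fin (Module.finrank ℂ E)) :=
      Function.Embedding.nonempty_of_card_le (by simpa using hA)
    exact ⟨_, (stdOrthonormalBasis ℂ E).orthonormal.comp g g.injective⟩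
  · obtain ⟨w, b, hb⟩ := exists_hilbertBasis ℂ E
    have hw : Infinite w := by
      by_contra hw
      rw [not_infinite_iff_finite] at hw
      have := Fintype.ofFinite w
      exact hfin (Module.Basis.finiteDimensional_of_finite b.toOrthonormalBasis.toBasis)
    obtain ⟨g, hg⟩ := exists_injective_nat A
    exact ⟨_, b.orthonormal.comp (fun a : A => Infinite.natEmbedding w (g a))
      ((Infinite.natEmbedding w).injective.comp hg)⟩

/-- Orthonormal families chosen in each eigenspace combine, since distinct eigenspaces are
orthogonal. For `μ ≠ 0` the eigenspace is finite-dimensional and the count exact, so the family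
spans it. Only kernel vectors can be missed. -/
theorem exists_orthonormal_eigenvectors [CompleteSpace H] {T : H →L[ℂ] H} (hT : T.IsSymmetric)
    (hc : IsCompactOperator T) {s : ℕ → ℝ} (hs : HasEigenvalueSequence T s) :
    ∃ e : ℕ → H, Orthonormal ℂ e ∧ (∀ k, T (e k) = (s k : ℂ) • e k) ∧
      ∀ y, (∀ k, inner ℂ (e k) y = 0) → T y = 0 := by
  have hE (μ : ℂ) : ∃ f : ℕ → H,
      Orthonormal ℂ (fun k : {k : ℕ | (s k : ℂ) = μ} => f k) ∧
      (∀ k, (s k : ℂ) = μ → f k ∈ Module.End.eigenspace (T : H →ₗ[ℂ] H) μ) ∧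
      (μ ≠ 0 → ∀ x ∈ Module.End.eigenspace (T : H →ₗ[ℂ] H) μ,
        x ∈ Submodule.span ℂ (f '' {k : ℕ | (s k : ℂ) = μ})) := by
    have hle : {k : ℕ | (s k : ℂ) = μ}.encard ≤
        Cardinal.toENat (Module.rank ℂ (Module.End.eigenspace (T : H →ₗ[ℂ] H) μ)) := by
      by_cases hμ : μ = 0
      · subst hμ
        rw [Module.End.eigenspace_zero]
        simpa using hs.2
      · exact (hs.1 μ hμ).le
    have : CompleteSpace (Module.End.eigenspace (T : H →ₗ[ℂ] H) μ) := by
      have hcl : IsClosed (Module.End.eigenspace (T : H →ₗ[ℂ] H) μ : Set H) := by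
        have : (Module.End.eigenspace (T : H →ₗ[ℂ] H) μ : Set H) = {x | T x = μ • x} := by
          ext x
          exact Module.End.mem_eigenspace_iff
        rw [this]
        exact isClosed_eq T.continuous (continuous_const_smul μ)
      exact hcl.completeSpace_coe
    obtain ⟨g, hg⟩ := exists_orthonormal_subtype _ _ hle
    classical
    refine ⟨fun k => if h : (s k : ℂ) = μ then g ⟨k, h⟩ else 0, ⟨fun k => ?_, fun k l hkl => ?_⟩,
      fun k hk => ?_, fun hμ x hx => ?_⟩
    · simpa [show (s k : ℂ) = μ from k.2] using hg.1 k
    · simpa [show (s k : ℂ) = μ from k.2, show (s l : ℂ) = μ from l.2] using hg.2 hkl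
    · simp [hk]
    · have := ContinuousLinearMap.finite_dimensional_eigenspace hc μ hμ
      have hcard := hs.1 μ hμ
      rw [← Module.finrank_eq_rank, Cardinal.toENat_nat] at hcard
      have hAf : {k : ℕ | (s k : ℂ) = μ}.Finite :=
        Set.encard_lt_top_iff.mp (hcard.trans_lt (ENat.natCast_lt_top _))
      have := hAf.fintype
      rw [Set.encard_eq_coe_toFinset_card, Set.toFinset_card, Nat.cast_inj] at hcard
      have hspan := hg.linearIndependent.span_eq_top_of_card_eq_finrank' hcard
      have hx' : (⟨x, hx⟩ : Module.End.eigenspace (T : H →ₗ[ℂ] H) μ) ∈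
          Submodule.span ℂ (Set.range g) := hspan ▸ Submodule.mem_top
      have := Submodule.mem_map_of_mem
        (f := (Module.End.eigenspace (T : H →ₗ[ℂ] H) μ).subtype) hx'
      rw [Submodule.map_span] at this
      refine Submodule.span_mono ?_ this
      rintro _ ⟨_, ⟨k, rfl⟩, rfl⟩
      exact ⟨k, k.2, by simp [show (s k : ℂ) = μ from k.2]⟩
  choose f hfo hfm hfs using hE
  refine ⟨fun k => f (s k) k, ⟨fun k => (hfo (s k)).1 ⟨k, rfl⟩, fun k l hkl => ?_⟩, fun k => ?_,
    fun y hy => ?_⟩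
  · by_cases hs : (s k : ℂ) = s l
    · have := (hfo (s k)).2 (i := ⟨k, rfl⟩) (j := ⟨l, hs.symm⟩) (by simpa using hkl)
      simpa [hs] using this
    · exact hT.orthogonalFamily_eigenspaces hs ⟨_, hfm _ k rfl⟩ ⟨_, hfm _ l rfl⟩
  · exact Module.End.mem_eigenspace_iff.mp (hfm (s k) k rfl)
  -- `T y` is orthogonal to every eigenspace, and the eigenspaces of a compact symmetric operator
  -- have trivial common orthogonal complement.
  · have h : T y ∈ (⨆ μ, Module.End.eigenspace (T : H →ₗ[ℂ] H) μ)ᗮ := by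
      rw [← Submodule.iInf_orthogonal, Submodule.mem_iInf]
      intro μ x hx
      have hxy : inner ℂ x (T y) = inner ℂ (μ • x) y := by
        rw [← Module.End.mem_eigenspace_iff.mp hx]
        exact (hT x y).symm
      rw [hxy]
      by_cases hμ : μ = 0
      · simp [hμ]
      · have hy' : y ∈ (Submodule.span ℂ (f μ '' {k : ℕ | (s k : ℂ) = μ}))ᗮ := by
          rw [Submodule.mem_orthogonal]
          intro u hu
          induction hu using Submodule.span_induction with
          | mem u hu =>
            obtain ⟨k, rfl, rfl⟩ := hu
            exact hy k
          | zero => simp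
          | add u v _ _ hu hv => rw [inner_add_left, hu, hv, add_zero]
          | smul c u _ hu => rw [inner_smul_left, hu, mul_zero]
        rw [inner_smul_left, hy' x (hfs μ hμ x hx), mul_zero]
    rwa [ContinuousLinearMap.orthogonalComplement_iSup_eigenspaces_eq_bot hc hT,
      Submodule.mem_bot] at h

end Hilbert

/-! ### The increment condition suffices -/

theorem IncrementCondition.isCommutatorOfCompacts {H : Type*} [NormedAddCommGroup H]
    [InnerProductSpace ℂ H] [CompleteSpace H] {d : ℕ → ℝ} (hd : IncrementCondition d)
    {T : H →L[ℂ] H} (hT : T.IsPositive) (hc : IsCompactOperator T)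
    (hs : HasEigenvalueSequence T (incrementEigenvalues d)) : IsCommutatorOfCompacts T := by
  classical
  obtain ⟨e, heo, heT, hker⟩ := exists_orthonormal_eigenvectors hT.isSymmetric hc hs
  obtain ⟨φ, hφ⟩ := exists_equiv_blockNumber
  -- This solves the recursion `a n (n + 2) - a (n - 1) n = (d (n + 1) - d n) / (n + 1)` with `2 a 0
  -- = d 1`.
  let a (n : ℕ) : ℝ := d (n + 1) / ((n + 1) * (n + 2))
  have ha (n : ℕ) : 0 ≤ a n := div_nonneg (hd.1 _ n.succ_pos) (by positivity)
  have hlim : Tendsto (fun n : ℕ => a n * (n + 1)) atTop (𝓝 0) := by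
    refine squeeze_zero (fun n => mul_nonneg (ha n) (by positivity)) (fun n => ?_)
      (hd.2.2.comp (tendsto_add_atTop_nat 1))
    simp only [a, Function.comp_apply, Nat.cast_add, Nat.cast_one]
    rw [div_mul_eq_mul_div, mul_comm ((n : ℝ) + 1) (n + 2),
      mul_div_mul_right _ _ (by positivity : (n : ℝ) + 1 ≠ 0)]
    exact div_le_div_of_nonneg_left (hd.1 _ n.succ_pos) (by positivity) (by linarith)
  obtain ⟨C, Z, hC, hZ, hCZ⟩ := exists_compact_commutator_total_degree ha hlim
  have hCZ' (x) (p : ℕ × ℕ) :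
      (C (Z x) - Z (C x)) p = (incrementEigenvalues d (φ.symm p) : ℂ) * x p := by
    rw [hCZ]
    congr 2
    have hb := hφ (φ.symm p)
    rw [Equiv.apply_symm_apply] at hb
    rw [incrementEigenvalues, repeatBlocks, ← hb, ← Nat.cast_add]
    generalize p.1 + p.2 = N
    rcases N with _ | N
    · simp [a]
    · rw [if_neg (by omega)]
      simp only [a, Nat.add_sub_cancel]
      push_cast
      field_simp
      ring
  have heo' : Orthonormal ℂ (e ∘ φ.symm) := heo.comp _ φ.symm.injective
  let V := heo'.orthogonalFamily.linearIsometry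
  have hV (p : ℕ × ℕ) (c : ℂ) : V (lp.single 2 p c) = c • e (φ.symm p) := by
    simp [V, OrthogonalFamily.linearIsometry_apply_single]
  refine IsCommutatorOfCompacts.of_isometry V hC hZ (fun x => ?_) fun y hy => hker y fun k => ?_
  · have : T ∘L V.toContinuousLinearMap =
        V.toContinuousLinearMap ∘L (C ∘L Z - Z ∘L C) := by
      refine lp.ext_continuousLinearMap (by simp) fun p => ?_
      ext
      have h1 : C (Z (lp.single 2 p 1)) - Z (C (lp.single 2 p 1)) =
          lp.single 2 p (incrementEigenvalues d (φ.symm p) : ℂ) := by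
        ext q
        rw [hCZ']
        by_cases hq : q = p
        · subst hq; simp
        · simp [lp.single_apply, hq]
      change T (V (lp.single 2 p 1)) = V (C (Z (lp.single 2 p 1)) - Z (C (lp.single 2 p 1)))
      rw [h1, hV, hV, one_smul, heT]
    exact congrArg (fun S => S x) this
  · simpa [hV] using hy (lp.single 2 (φ k) 1)

/-! ### Equivalence of the two conditions by differences and partial sums -/

theorem incrementEigenvalues_eq_directEigenvalues_sub (d : ℕ → ℝ) :
    incrementEigenvalues d = directEigenvalues fun n => if n = 1 then d 1 else d n - d (n - 1) := by
  funext k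
  simp only [incrementEigenvalues, directEigenvalues, repeatBlocks]
  split_ifs with h
  · simp [h]
  · rfl

theorem directEigenvalues_eq_incrementEigenvalues_sum (d : ℕ → ℝ) :
    directEigenvalues d = incrementEigenvalues fun n => ∑ j ∈ Finset.Icc 1 n, d j := by
  rw [incrementEigenvalues_eq_directEigenvalues_sub]
  funext k
  simp only [directEigenvalues, repeatBlocks]
  congr 1
  obtain ⟨n, hn⟩ := Nat.exists_eq_add_of_lt (blockNumber_pos k)
  rw [hn]
  split_ifs with h
  · obtain rfl : n = 0 := by omega
    simp
  · rw [show 0 + n + 1 - 1 = n by omega, show 0 + n + 1 = n + 1 by omega,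
      Finset.sum_Icc_succ_top (by omega)]
    ring

theorem sum_increments (d : ℕ → ℝ) {n : ℕ} (hn : 1 ≤ n) :
    ∑ j ∈ Finset.Icc 1 n, (if j = 1 then d 1 else d j - d (j - 1)) = d n := by
  induction n, hn using Nat.le_induction with
  | base => simp
  | succ n hn ih =>
    rw [Finset.sum_Icc_succ_top (by omega), ih, if_neg (by omega), Nat.add_sub_cancel]
    ring

theorem IncrementCondition.meanCondition {d : ℕ → ℝ} (hd : IncrementCondition d) :
    MeanCondition fun n => if n = 1 then d 1 else d n - d (n - 1) := by
  refine ⟨fun n hn => ?_, hd.2.2.congr' ?_⟩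
  · dsimp only
    split_ifs with h
    · exact hd.1 1 le_rfl
    · have := hd.2.1 (n - 1) (by omega)
      rw [Nat.sub_add_cancel hn] at this
      exact sub_nonneg.mpr this
  · filter_upwards [eventually_ge_atTop 1] with n hn
    rw [sum_increments d hn]
    ring

theorem MeanCondition.incrementCondition {d : ℕ → ℝ} (hd : MeanCondition d) :
    IncrementCondition fun n => ∑ j ∈ Finset.Icc 1 n, d j := by
  refine ⟨fun n _ => Finset.sum_nonneg fun j hj => hd.1 j (Finset.mem_Icc.mp hj).1, fun n _ => ?_,
    hd.2.congr fun n => by ring⟩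
  dsimp only
  rw [Finset.sum_Icc_succ_top (by omega)]
  exact le_add_of_nonneg_right (hd.1 _ (by omega))

/-! ### Increment eigenvalues form a nonnegative null sequence -/

theorem IncrementCondition.incrementEigenvalues_nonneg {d : ℕ → ℝ} (hd : IncrementCondition d)
    (k : ℕ) : 0 ≤ incrementEigenvalues d k := by
  rw [incrementEigenvalues_eq_directEigenvalues_sub]
  exact div_nonneg (hd.meanCondition.1 _ (blockNumber_pos k)) (Nat.cast_nonneg _)

theorem IncrementCondition.tendsto_incrementEigenvalues {d : ℕ → ℝ} (hd : IncrementCondition d) :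
    Tendsto (incrementEigenvalues d) cofinite (𝓝 0) := by
  refine squeeze_zero' (Eventually.of_forall hd.incrementEigenvalues_nonneg) ?_
    (hd.2.2.comp tendsto_blockNumber)
  filter_upwards [tendsto_blockNumber.eventually_gt_atTop 1] with k hk
  simp only [incrementEigenvalues, repeatBlocks, if_neg hk.ne', Function.comp_apply]
  gcongr
  exact sub_le_self _ (hd.1 _ (by omega))

/-! ### Diagonal operators with a prescribed eigenvalue sequence -/

section Hilbert

variable {H : Type*} [NormedAddCommGroup H] [InnerProductSpace ℂ H]

/-- Orthonormal vectors lie at distance `√2`, so balls of radius `1/2` around them are disjoint. -/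
theorem Orthonormal.countable [TopologicalSpace.SeparableSpace H] {ι : Type*} {v : ι → H}
    (hv : Orthonormal ℂ v) : Countable ι := by
  have hd : Pairwise fun i j => (1 : ℝ) ≤ dist (v i) (v j) := by
    intro i j hij
    have h : ‖v i - v j‖ ^ 2 = 2 := by
      rw [@norm_sub_sq ℂ, hv.1, hv.1, hv.2 hij]
      norm_num
    rw [dist_eq_norm]
    nlinarith [norm_nonneg (v i - v j)]
  have hdisj : Pairwise (Function.onFun Disjoint fun i => Metric.ball (v i) (1 / 2)) := by
    intro i j hij
    exact Metric.ball_disjoint_ball (by linarith [hd hij])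
  exact Pairwise.countable_of_isOpen_disjoint hdisj (fun i => Metric.isOpen_ball)
    fun i => ⟨v i, Metric.mem_ball_self (by norm_num)⟩

theorem exists_hilbertBasis_nat [CompleteSpace H] [TopologicalSpace.SeparableSpace H]
    (hH : ¬ FiniteDimensional ℂ H) : Nonempty (HilbertBasis ℕ ℂ H) := by
  obtain ⟨w, b, hb⟩ := exists_hilbertBasis ℂ H
  have hw : Infinite w := by
    by_contra hw
    rw [not_infinite_iff_finite] at hw
    have := Fintype.ofFinite w
    exact hH (Module.Basis.finiteDimensional_of_finite b.toOrthonormalBasis.toBasis)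
  have := b.orthonormal.countable
  obtain ⟨g⟩ := nonempty_equiv_of_countable (α := ℕ) (β := w)
  refine ⟨HilbertBasis.mk (b.orthonormal.comp g g.injective) ?_⟩
  rw [g.surjective.range_comp, b.dense_span]

/-- The compact operator with a given diagonal. -/
theorem HilbertBasis.exists_diagonal {ι : Type*} (b : HilbertBasis ι ℂ H) {s : ι → ℝ}
    (hs : Tendsto s cofinite (𝓝 0)) :
    ∃ T : H →L[ℂ] H, IsCompactOperator T ∧ ∀ x i, b.repr (T x) i = s i * b.repr x i := by
  have hs' : Tendsto (fun i => (s i : ℂ)) cofinite (𝓝 0) :=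
    Complex.ofReal_zero ▸ (Complex.continuous_ofReal.tendsto 0).comp hs
  obtain ⟨D, hD, hD'⟩ := exists_isCompactOperator_weightedComp (τ := id) hs'
    (Set.injOn_id _)
  refine ⟨b.repr.symm.toContinuousLinearEquiv.toContinuousLinearMap ∘L D ∘L
    b.repr.toContinuousLinearEquiv.toContinuousLinearMap,
    (hD.comp_clm b.repr.toContinuousLinearEquiv.toContinuousLinearMap).clm_comp
      b.repr.symm.toContinuousLinearEquiv.toContinuousLinearMap, fun x i => ?_⟩
  simp [hD']

theorem HilbertBasis.hasSum_inner_diagonal {ι : Type*} (b : HilbertBasis ι ℂ H) {s : ι → ℝ}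
    {T : H →L[ℂ] H} (hT : ∀ x i, b.repr (T x) i = s i * b.repr x i) (x : H) :
    HasSum (fun i => s i * ‖b.repr x i‖ ^ 2) (RCLike.re (inner ℂ (T x) x)) := by
  have h := lp.hasSum_inner (𝕜 := ℂ) (b.repr (T x)) (b.repr x)
  rw [b.repr.inner_map_map] at h
  have h' := RCLike.hasSum_re ℂ h
  convert! h' using 2 with i
  rw [hT, ← smul_eq_mul (s i : ℂ), inner_smul_left, inner_self_eq_norm_sq_to_K, Complex.conj_ofReal]
  change _ = ((s i : ℂ) * ((‖b.repr x i‖ : ℝ) : ℂ) ^ 2).re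
  rw [Complex.re_ofReal_mul, ← Complex.ofReal_pow, Complex.ofReal_re]

theorem HilbertBasis.isPositive_diagonal {ι : Type*} (b : HilbertBasis ι ℂ H) {s : ι → ℝ}
    (hs : ∀ i, 0 ≤ s i) {T : H →L[ℂ] H} (hT : ∀ x i, b.repr (T x) i = s i * b.repr x i) :
    T.IsPositive := by
  refine ⟨fun x y => ?_, fun x => ?_⟩
  · have h1 := lp.inner_eq_tsum (𝕜 := ℂ) (b.repr (T x)) (b.repr y)
    have h2 := lp.inner_eq_tsum (𝕜 := ℂ) (b.repr x) (b.repr (T y))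
    rw [b.repr.inner_map_map] at h1 h2
    refine (h1.trans (tsum_congr fun i => ?_)).trans h2.symm
    rw [hT, hT, ← smul_eq_mul, ← smul_eq_mul, inner_smul_left, inner_smul_right,
      Complex.conj_ofReal]
  · exact (b.hasSum_inner_diagonal hT x).nonneg fun i => mul_nonneg (hs i) (sq_nonneg _)

theorem HilbertBasis.isStrictlyPositiveOperator_diagonal {ι : Type*} (b : HilbertBasis ι ℂ H)
    {s : ι → ℝ} (hs : ∀ i, 0 < s i) {T : H →L[ℂ] H}
    (hT : ∀ x i, b.repr (T x) i = s i * b.repr x i) : IsStrictlyPositiveOperator T := by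
  refine ⟨b.isPositive_diagonal (fun i => (hs i).le) hT, fun x hx => ?_⟩
  have h := b.hasSum_inner_diagonal hT x
  obtain ⟨i, hi⟩ : ∃ i, b.repr x i ≠ 0 := by
    by_contra! hc
    exact hx (b.repr.map_eq_zero_iff.mp (by ext i; simpa using hc i))
  exact (mul_pos (hs i) (by positivity)).trans_le
    (le_hasSum h i fun j _ => mul_nonneg (hs j).le (sq_nonneg _))

/-- Finiteness turns the basis expansion of an eigenvector into a finite sum, so the algebraic span
needs no closure. -/
theorem HilbertBasis.eigenspace_diagonal {ι : Type*} (b : HilbertBasis ι ℂ H) {s : ι → ℝ}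
    {T : H →L[ℂ] H} (hT : ∀ x i, b.repr (T x) i = s i * b.repr x i) {μ : ℂ}
    (hμ : {i | (s i : ℂ) = μ}.Finite) :
    Module.End.eigenspace (T : H →ₗ[ℂ] H) μ = Submodule.span ℂ (b '' {i | (s i : ℂ) = μ}) := by
  classical
  have hmem (x : H) : x ∈ Module.End.eigenspace (T : H →ₗ[ℂ] H) μ ↔
      ∀ i, (s i : ℂ) ≠ μ → b.repr x i = 0 := by
    rw [Module.End.mem_eigenspace_iff, ContinuousLinearMap.coe_coe, ← b.repr.injective.eq_iff,
      lp.ext_iff, funext_iff]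
    refine forall_congr' fun i => ?_
    rw [hT, map_smul, lp.coeFn_smul, Pi.smul_apply, smul_eq_mul, mul_eq_mul_right_iff]
    tauto
  refine le_antisymm (fun x hx => ?_) (Submodule.span_le.mpr ?_)
  · have h := b.hasSum_repr x
    have h' : x = ∑ i ∈ hμ.toFinset, b.repr x i • b i :=
      h.unique (hasSum_sum_of_ne_finset_zero fun i hi => by
        rw [(hmem x).mp hx i (by simpa using hi), zero_smul])
    rw [h']
    exact Submodule.sum_mem _ fun i hi => Submodule.smul_mem _ _
      (Submodule.subset_span ⟨i, by simpa using hi, rfl⟩)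
  · rintro _ ⟨j, rfl, rfl⟩
    refine (hmem _).mpr fun i hi => ?_
    rw [b.repr_self, lp.single_apply_ne]
    rintro rfl
    exact hi rfl

theorem HilbertBasis.rank_eigenspace_diagonal {ι : Type*} (b : HilbertBasis ι ℂ H) {s : ι → ℝ}
    {T : H →L[ℂ] H} (hT : ∀ x i, b.repr (T x) i = s i * b.repr x i) {μ : ℂ}
    (hμ : {i | (s i : ℂ) = μ}.Finite) :
    Cardinal.toENat (Module.rank ℂ (Module.End.eigenspace (T : H →ₗ[ℂ] H) μ)) =
      {i | (s i : ℂ) = μ}.encard := by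
  have hli := b.orthonormal.linearIndependent
  rw [b.eigenspace_diagonal hT hμ,
    rank_span_set (hli.linearIndepOn_id.mono (Set.image_subset_range _ _)),
    ← hli.injective.encard_image]
  rfl

/-- A null sequence takes each nonzero value finitely often; for the value 0 this is a separate
hypothesis. -/
theorem HilbertBasis.hasEigenvalueSequence_diagonal (b : HilbertBasis ℕ ℂ H) {s : ℕ → ℝ}
    (hs : Tendsto s cofinite (𝓝 0)) (hs0 : {k | s k = 0}.Finite) {T : H →L[ℂ] H}
    (hT : ∀ x i, b.repr (T x) i = s i * b.repr x i) : HasEigenvalueSequence T s := by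
  refine ⟨fun μ hμ => (b.rank_eigenspace_diagonal hT ?_).symm, ?_⟩
  · have hs' : Tendsto (fun i => (s i : ℂ)) cofinite (𝓝 0) :=
      Complex.ofReal_zero ▸ (Complex.continuous_ofReal.tendsto 0).comp hs
    have := hs'.eventually_ne hμ.symm
    simpa [Filter.eventually_cofinite] using this
  · rw [← Module.End.eigenspace_zero, b.rank_eigenspace_diagonal hT (by simpa using hs0)]
    simp

end Hilbert

/-! ### The examples and the final assembly -/

theorem incrementCondition_sqrt : IncrementCondition fun n => √(n : ℝ) := by
  refine ⟨fun n _ => Real.sqrt_nonneg _, fun n _ => Real.sqrt_le_sqrt (by simp), ?_⟩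
  simp only [Real.sqrt_div_self]
  have := (Real.tendsto_sqrt_atTop.comp (tendsto_natCast_atTop_atTop (R := ℝ))).inv_tendsto_atTop
  exact this.congr fun n => by simp

theorem incrementCondition_log : IncrementCondition fun n => Real.log n := by
  refine ⟨fun n _ => Real.log_natCast_nonneg n, fun n hn => ?_, ?_⟩
  · exact Real.log_le_log (by exact_mod_cast hn) (by simp)
  · exact (Real.isLittleO_log_id_atTop.tendsto_div_nhds_zero).comp tendsto_natCast_atTop_atTop

theorem incrementCondition_log_add_one : IncrementCondition fun n => Real.log (n + 1) := by
  refine ⟨fun n _ => Real.log_nonneg (by simp), fun n hn => ?_, ?_⟩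
  · exact Real.log_le_log (by positivity) (by simp)
  · have h1 := incrementCondition_log.2.2.comp (tendsto_add_atTop_nat 1)
    -- The factor 2 comes from `n + 1 ≤ 2 n`, which replaces the denominator `n` by `n + 1`.
    have h2 := h1.const_mul 2
    rw [mul_zero] at h2
    refine squeeze_zero' (Eventually.of_forall fun n => div_nonneg (Real.log_nonneg (by simp))
      n.cast_nonneg) ?_ h2
    filter_upwards [eventually_ge_atTop 1] with n hn
    have hn' : (1 : ℝ) ≤ n := by exact_mod_cast hn
    simp only [Function.comp_apply, Nat.cast_add, Nat.cast_one]
    rw [mul_div_assoc', div_le_div_iff₀ (by linarith) (by linarith)]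
    have := Real.log_nonneg (show (1 : ℝ) ≤ n + 1 by linarith)
    nlinarith

theorem incrementEigenvalues_pos {d : ℕ → ℝ} (hd : ∀ n, 1 ≤ n → d n < d (n + 1)) {k : ℕ}
    (hk : blockNumber k ≠ 1) : 0 < incrementEigenvalues d k := by
  have hpos := blockNumber_pos k
  simp only [incrementEigenvalues, repeatBlocks, if_neg hk]
  refine div_pos ?_ (by exact_mod_cast hpos)
  have := hd (blockNumber k - 1) (by omega)
  rw [Nat.sub_add_cancel hpos] at this
  exact sub_pos.mpr this

theorem incrementEigenvalues_of_blockNumber_eq_one (d : ℕ → ℝ) {k : ℕ} (hk : blockNumber k = 1) :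
    incrementEigenvalues d k = d 1 := by
  simp [incrementEigenvalues, repeatBlocks, hk]

theorem blockNumber_eq_one_iff (k : ℕ) : blockNumber k = 1 ↔ k = 0 := by
  rw [blockNumber_eq_succ_iff k 0]
  simp

theorem exists_isStrictlyPositiveOperator_incrementEigenvalues {H : Type*} [NormedAddCommGroup H]
    [InnerProductSpace ℂ H] [CompleteSpace H] [TopologicalSpace.SeparableSpace H]
    (hH : ¬ FiniteDimensional ℂ H) {d : ℕ → ℝ} (hd : IncrementCondition d) (h1 : 0 < d 1)
    (hlt : ∀ n, 1 ≤ n → d n < d (n + 1)) :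
    ∃ T : H →L[ℂ] H, IsStrictlyPositiveOperator T ∧ IsCompactOperator T ∧
      HasEigenvalueSequence T (incrementEigenvalues d) ∧ IsCommutatorOfCompacts T := by
  obtain ⟨b⟩ := exists_hilbertBasis_nat hH
  obtain ⟨T, hTc, hT⟩ := b.exists_diagonal hd.tendsto_incrementEigenvalues
  have hpos (k : ℕ) : 0 < incrementEigenvalues d k := by
    by_cases hk : blockNumber k = 1
    · rwa [incrementEigenvalues_of_blockNumber_eq_one d hk]
    · exact incrementEigenvalues_pos hlt hk
  have hT' := b.isStrictlyPositiveOperator_diagonal hpos hT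
  have hTs := b.hasEigenvalueSequence_diagonal hd.tendsto_incrementEigenvalues
    (by simp [(hpos _).ne']) hT
  exact ⟨T, hT', hTc, hTs, hd.isCommutatorOfCompacts hT'.1 hTc hTs⟩

theorem exists_isPositive_incrementEigenvalues {H : Type*} [NormedAddCommGroup H]
    [InnerProductSpace ℂ H] [CompleteSpace H] [TopologicalSpace.SeparableSpace H]
    (hH : ¬ FiniteDimensional ℂ H) {d : ℕ → ℝ} (hd : IncrementCondition d) (h1 : d 1 = 0)
    (hlt : ∀ n, 1 ≤ n → d n < d (n + 1)) :
    ∃ T : H →L[ℂ] H, T.IsPositive ∧ IsCompactOperator T ∧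
      HasEigenvalueSequence T (incrementEigenvalues d) ∧
      Module.finrank ℂ (LinearMap.ker (T : H →ₗ[ℂ] H)) = 1 ∧ IsCommutatorOfCompacts T := by
  obtain ⟨b⟩ := exists_hilbertBasis_nat hH
  obtain ⟨T, hTc, hT⟩ := b.exists_diagonal hd.tendsto_incrementEigenvalues
  have hzero : {k | incrementEigenvalues d k = 0} = {0} := by
    ext k
    rw [Set.mem_ofPred_eq, Set.mem_singleton_iff, ← blockNumber_eq_one_iff]
    refine ⟨fun h => ?_, fun h => (incrementEigenvalues_of_blockNumber_eq_one d h).trans h1⟩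
    by_contra hk
    exact (incrementEigenvalues_pos hlt hk).ne' h
  have hT' := b.isPositive_diagonal hd.incrementEigenvalues_nonneg hT
  have hTs := b.hasEigenvalueSequence_diagonal hd.tendsto_incrementEigenvalues
    (by simp [hzero]) hT
  refine ⟨T, hT', hTc, hTs, ?_, hd.isCommutatorOfCompacts hT' hTc hTs⟩
  have h := b.rank_eigenspace_diagonal (μ := 0) hT (by simp [hzero])
  simp only [Complex.ofReal_eq_zero, hzero, Set.encard_singleton] at h
  rw [← Module.End.eigenspace_zero, Module.finrank, ← Cardinal.toNat_toENat, h]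
  rfl

theorem theorem3p1 {H : Type*} [NormedAddCommGroup H] [InnerProductSpace ℂ H] [CompleteSpace H]
    [TopologicalSpace.SeparableSpace H] (hH : ¬ FiniteDimensional ℂ H) :
    -- the condition on increments
    (∀ d : ℕ → ℝ, IncrementCondition d → ∀ T : H →L[ℂ] H, T.IsPositive → IsCompactOperator T →
      HasEigenvalueSequence T (incrementEigenvalues d) → IsCommutatorOfCompacts T) ∧
    -- the direct condition
    (∀ d : ℕ → ℝ, MeanCondition d → ∀ T : H →L[ℂ] H, T.IsPositive → IsCompactOperator T →
      HasEigenvalueSequence T (directEigenvalues d) → IsCommutatorOfCompacts T) ∧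
    -- the two conditions describe the same eigenvalue sequences
    (∀ s : ℕ → ℝ, (∃ d, IncrementCondition d ∧ s = incrementEigenvalues d) ↔
      ∃ d, MeanCondition d ∧ s = directEigenvalues d) ∧
    -- examples
    (IncrementCondition (fun n => Real.sqrt n) ∧
      ∃ T : H →L[ℂ] H, IsStrictlyPositiveOperator T ∧ IsCompactOperator T ∧
        HasEigenvalueSequence T (incrementEigenvalues fun n => Real.sqrt n) ∧
        IsCommutatorOfCompacts T) ∧
    (IncrementCondition (fun n => Real.log (n + 1)) ∧
      ∃ T : H →L[ℂ] H, IsStrictlyPositiveOperator T ∧ IsCompactOperator T ∧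
        HasEigenvalueSequence T (incrementEigenvalues fun n => Real.log (n + 1)) ∧
        IsCommutatorOfCompacts T) ∧
    (IncrementCondition (fun n => Real.log n) ∧
      ∃ T : H →L[ℂ] H, T.IsPositive ∧ IsCompactOperator T ∧
        HasEigenvalueSequence T (incrementEigenvalues fun n => Real.log n) ∧
        Module.finrank ℂ (LinearMap.ker (T : H →ₗ[ℂ] H)) = 1 ∧
        IsCommutatorOfCompacts T) := by

  have hinc : ∀ d : ℕ → ℝ, IncrementCondition d → ∀ T : H →L[ℂ] H, T.IsPositive →
      IsCompactOperator T → HasEigenvalueSequence T (incrementEigenvalues d) →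
      IsCommutatorOfCompacts T := fun d hd T hT hc hs => hd.isCommutatorOfCompacts hT hc hs
  refine ⟨hinc, fun d hd T hT hc hs => ?_, fun s => ⟨?_, ?_⟩,
    ⟨incrementCondition_sqrt, ?_⟩, ⟨incrementCondition_log_add_one, ?_⟩,
    ⟨incrementCondition_log, ?_⟩⟩
  · rw [directEigenvalues_eq_incrementEigenvalues_sum] at hs
    exact hinc _ hd.incrementCondition T hT hc hs
  · rintro ⟨d, hd, rfl⟩
    exact ⟨_, hd.meanCondition, incrementEigenvalues_eq_directEigenvalues_sub d⟩
  · rintro ⟨d, hd, rfl⟩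
    exact ⟨_, hd.incrementCondition, directEigenvalues_eq_incrementEigenvalues_sum d⟩
  · exact exists_isStrictlyPositiveOperator_incrementEigenvalues hH incrementCondition_sqrt
      (by simp) fun n _ => Real.sqrt_lt_sqrt n.cast_nonneg (by simp)
  · exact exists_isStrictlyPositiveOperator_incrementEigenvalues hH incrementCondition_log_add_one
      (Real.log_pos (by norm_num)) fun n _ => Real.log_lt_log (by positivity) (by simp)
  · exact exists_isPositive_incrementEigenvalues hH incrementCondition_log (by simp)
      fun n hn => Real.log_lt_log (by exact_mod_cast hn) (by simp)
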